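/- Let $G=(V,E)$ be an infinite, connected simple graph whose vertex degrees are bounded. Let $P^n(x,y)$ be the $n$-step transition probabilities of the lazy simple random walk on $G$, which at each step stays put with probability $1/2$ and otherwise moves to a uniformly chosen neighbour. Write $x\sim y$ when $x,y$ are adjacent, and for $n\ge 0$ set \[ \mathrm{TV}_n=\sup_{x\sim y}\frac12\sum_{z\in V}|P^n(x,z)-P^n(y,z)|,\qquad H^*_n=\sup_{x\in V}\max_{0\le m\le n}\sum_{y\in V}P^m(x,y)\bigl(-\log P^m(x,y)\bigr), \] with the convention $0\log 0=0$. For $W\subseteq V$ let $\partial W$ be the set of edges with one endpoint in $W$ and the other not in $W$, and let \[ \Phi(n)=\inf\Bigl\{\frac{|\partial W|}{\sum_{w\in W}\deg(w)} : W\subseteq V \text{ finite and non-empty},\ \sum_{w\in W}\deg(w)\le n\Bigr\} \] be the isoperimetric profile of $G$. If $\alpha,\beta\in(0,1]$ are such that $H^*_n=O(n^\alpha)$ and $\mathrm{TV}_n=O(n^{-\beta})$ as $n\to\infty$, then \[ \Phi(n)=O\left(\left(\frac{\log\log n}{\log n}\right)^{\beta/\alpha}\right)\qquad\text{as } n\to\infty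 . \] -/

import Mathlib

open Filter Asymptotics

noncomputable section

namespace LazyWalk

/-- The edge boundary: the edges with one endpoint in `W` and the other not in `W`. -/
def edgeBoundary {V : Type*} (G : SimpleGraph V) (W : Set V) : Set (Sym2 V) :=
  {e | e ∈ G.edgeSet ∧ ∃ x ∈ W, ∃ y ∉ W, e = s(x, y)}

variable {V : Type*} (G : SimpleGraph V) [G.LocallyFinite]

open Classical in
/-- One-step transition probabilities of the lazy simple random walk: stay put with probability
`1/2`, otherwise jump to a uniformly chosen neighbour. -/
def step (x y : V) : ℝ :=
  (1 / 2) * (if x = y then 1 else 0) + (1 / 2) * (if G.Adj x y then 1 / (G.degree x : ℝ) else 0)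

open Classical in
/-- The `n`-step transition probabilities `P^n(x, y)`, i.e. the powers of the matrix `step G`.
For a locally finite graph the sum has only finitely many nonzero terms. -/
def P : ℕ → V → V → ℝ
  | 0, x, y => if x = y then 1 else 0
  | n + 1, x, y => ∑' z, step G x z * P n z y

/-- Total variation distance between `P^n(x, ·)` and `P^n(y, ·)`. -/
def tvDist (n : ℕ) (x y : V) : ℝ := (1 / 2) * ∑' z, |P G n x z - P G n y z|

/-- The total variation profile `TV_n`: the supremum over pairs of neighbours. -/
def tvProfile (n : ℕ) : ℝ := ⨆ e : {e : V × V // G.Adj e.1 e.2}, tvDist G n e.1.1 e.1.2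

/-- The entropy of `P^m(x, ·)`, with the convention `0 log 0 = 0`. -/
def entropy (m : ℕ) (x : V) : ℝ := ∑' y, P G m x y * (-Real.log (P G m x y))

/-- The entropy profile `H*_n`: the supremum over starting points of the maximal entropy
of the walk at the times `0, …, n`. -/
def entropyProfile (n : ℕ) : ℝ := ⨆ x : V, ⨆ m : Fin (n + 1), entropy G m x

/-- The volume of a finite set of vertices: the sum of the degrees. -/
def vol (W : Finset V) : ℕ := ∑ w ∈ W, G.degree w

/-- The isoperimetric profile: the infimum of the ratio of edge boundary to volume
over nonempty finite sets of vertices of volume at most `n`. -/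
def isoProfile (n : ℕ) : ℝ :=
  sInf {r : ℝ | ∃ W : Finset V, W.Nonempty ∧ vol G W ≤ n ∧
    r = ((edgeBoundary G W).ncard : ℝ) / (vol G W : ℝ)}

end LazyWalk

end

/-! The core is `isoProfile_le_tvProfile`: if every entropy at time n is at most H, then Φ(N) ≤ 8
TV_n as soon as N ≥ 2M exp(2H). The corollary follows by taking n of order (log N)^{1/α}; this even
gives (1 / log N)^{β/α}, without the iterated logarithm.

For the core, truncate the density P^n(x,z) / deg z at a height σ of order exp(-2H) and take its
outgoing gradient T(x,z) in x. For fixed z the truncated density lives on volume at most 1/σ, and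
the entropy bound keeps mass at least 1/4, so the coarea inequality gives ∑_x T(x,z) ≥ Φ(N)/4. For
fixed x, comparing neighbours gives ∑_z deg z · T(x,z) ≤ 2 deg x · TV_n. Were V finite, summing both
over all vertices would finish.

On an infinite graph the sums are weighted by an almost invariant function u. Since T(x,z) is
dominated by the n-step kernel, moving the weight from z to x costs at most n times the one-step
oscillation of u, which can be made arbitrarily small with n fixed. Such u exist because TV_n → 0
makes the entropy sublinear: at some time k the entropy increment is small, and then u = P^k(·,o) is
nearly constant along a step (`exists_oscillation_le`). -/

noncomputable section

namespace LazyWalk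

variable {V : Type*} (G : SimpleGraph V) [G.LocallyFinite]

/-! ### The kernel of the lazy walk: finite supports, reversibility, invariance of the degree
measure -/

open Classical in
/-- The closed neighbourhood of a vertex. -/
def closedNbhd (x : V) : Finset V := insert x (G.neighborFinset x)

variable {G}

lemma mem_closedNbhd {x y : V} : y ∈ closedNbhd G x ↔ y = x ∨ G.Adj x y := by
  simp [closedNbhd]

lemma mem_closedNbhd_comm {x y : V} : y ∈ closedNbhd G x ↔ x ∈ closedNbhd G y := by
  rw [mem_closedNbhd, mem_closedNbhd, G.adj_comm, eq_comm]

lemma self_mem_closedNbhd (x : V) : x ∈ closedNbhd G x := mem_closedNbhd.2 (Or.inl rfl)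

open Classical in
lemma card_closedNbhd_le {M : ℕ} (hdeg : ∀ v, G.degree v ≤ M) (x : V) :
    (closedNbhd G x).card ≤ M + 1 := by
  refine (Finset.card_insert_le _ _).trans ?_
  have := hdeg x
  rw [G.card_neighborFinset_eq_degree]
  omega

lemma step_nonneg (x y : V) : 0 ≤ step G x y := by
  unfold step
  positivity

lemma step_eq_zero {x y : V} (h : y ∉ closedNbhd G x) : step G x y = 0 := by
  rw [mem_closedNbhd, not_or] at h
  simp [step, h.2, Ne.symm h.1]

lemma step_self (x : V) : step G x x = 1 / 2 := by
  simp [step]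

lemma sum_step (hd : ∀ v, 0 < G.degree v) (x : V) : ∑ y ∈ closedNbhd G x, step G x y = 1 := by
  classical
  have hx : (G.degree x : ℝ) ≠ 0 := by exact_mod_cast (hd x).ne'
  have h0 : x ∉ G.neighborFinset x := by simp
  rw [closedNbhd, Finset.sum_insert (by simp), step_self]
  have : ∀ y ∈ G.neighborFinset x, step G x y = (1 / 2) * (1 / (G.degree x : ℝ)) := by
    intro y hy
    rw [SimpleGraph.mem_neighborFinset] at hy
    simp [step, hy, hy.ne]
  rw [Finset.sum_congr rfl this, Finset.sum_const, G.card_neighborFinset_eq_degree, nsmul_eq_mul]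
  field_simp
  norm_num

lemma degree_mul_step (hd : ∀ v, 0 < G.degree v) (x y : V) :
    (G.degree x : ℝ) * step G x y = G.degree y * step G y x := by
  have hx : (G.degree x : ℝ) ≠ 0 := by exact_mod_cast (hd x).ne'
  have hy : (G.degree y : ℝ) ≠ 0 := by exact_mod_cast (hd y).ne'
  by_cases hxy : x = y
  · rw [hxy]
  · by_cases h : G.Adj x y
    · simp [step, hxy, Ne.symm hxy, h, h.symm]
      field_simp
    · simp [step, hxy, Ne.symm hxy, h, mt G.adj_symm h]

lemma tsum_step_mul (x : V) (f : V → ℝ) :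
    ∑' y, step G x y * f y = ∑ y ∈ closedNbhd G x, step G x y * f y :=
  tsum_eq_sum fun y hy => by rw [step_eq_zero hy, zero_mul]

lemma P_succ (n : ℕ) (x z : V) :
    P G (n + 1) x z = ∑ y ∈ closedNbhd G x, step G x y * P G n y z := by
  rw [P, tsum_step_mul]

lemma P_one (x y : V) : P G 1 x y = step G x y := by
  classical
  rw [P_succ]
  simp only [P, mul_ite, mul_one, mul_zero, Finset.sum_ite_eq', ite_eq_left_iff]
  exact fun h => (step_eq_zero h).symm

lemma P_nonneg (n : ℕ) (x z : V) : 0 ≤ P G n x z := by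
  induction n generalizing x with
  | zero => unfold P; positivity
  | succ n ih =>
    rw [P_succ]
    exact Finset.sum_nonneg fun y _ => mul_nonneg (step_nonneg x y) (ih y)

lemma finite_support_P (n : ℕ) (x : V) : (Function.support (P G n x)).Finite := by
  induction n generalizing x with
  | zero =>
    refine (Set.finite_singleton x).subset fun z hz => ?_
    by_contra h
    exact hz (by simp [P, Ne.symm h])
  | succ n ih =>
    refine ((closedNbhd G x).finite_toSet.biUnion fun y _ => ih y).subset fun z hz => ?_
    rw [Function.mem_support, P_succ] at hz
    obtain ⟨y, hy, hyz⟩ := Finset.exists_ne_zero_of_sum_ne_zero hz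
    exact Set.mem_biUnion hy (right_ne_zero_of_mul hyz)

lemma summable_P_mul (n : ℕ) (x : V) (f : V → ℝ) : Summable fun z => P G n x z * f z :=
  summable_of_hasFiniteSupport ((finite_support_P n x).subset fun _ hz => left_ne_zero_of_mul hz)

lemma summable_P (n : ℕ) (x : V) : Summable (P G n x) :=
  summable_of_hasFiniteSupport (finite_support_P n x)

lemma tsum_P (hd : ∀ v, 0 < G.degree v) (n : ℕ) (x : V) : ∑' z, P G n x z = 1 := by
  classical
  induction n generalizing x with
  | zero => simp [P]
  | succ n ih =>
    simp_rw [P_succ]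
    rw [Summable.tsum_finsetSum fun y _ => (summable_P n y).mul_left _]
    simp_rw [tsum_mul_left, ih, mul_one]
    exact sum_step hd x

lemma P_le_one (hd : ∀ v, 0 < G.degree v) (n : ℕ) (x z : V) : P G n x z ≤ 1 := by
  rw [← tsum_P hd n x]
  exact (summable_P n x).le_tsum z fun y _ => P_nonneg n x y

lemma P_succ_right (n : ℕ) (x z : V) :
    P G (n + 1) x z = ∑ y ∈ closedNbhd G z, P G n x y * step G y z := by
  classical
  induction n generalizing x with
  | zero =>
    rw [P_one]
    simp only [P, ite_mul, one_mul, zero_mul, Finset.sum_ite_eq]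
    split_ifs with h
    · rfl
    · exact step_eq_zero (mt mem_closedNbhd_comm.1 h)
  | succ n ih =>
    rw [P_succ]
    simp_rw [ih, P_succ n x, Finset.mul_sum, Finset.sum_mul]
    rw [Finset.sum_comm]
    simp_rw [mul_assoc]

lemma degree_mul_P (hd : ∀ v, 0 < G.degree v) (n : ℕ) (x z : V) :
    (G.degree x : ℝ) * P G n x z = G.degree z * P G n z x := by
  induction n generalizing x z with
  | zero =>
    by_cases h : x = z
    · rw [h]
    · simp [P, h, Ne.symm h]
  | succ n ih =>
    rw [P_succ_right, P_succ, Finset.mul_sum, Finset.mul_sum]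
    refine Finset.sum_congr rfl fun y _ => ?_
    rw [← mul_assoc, ih, mul_right_comm, degree_mul_step hd]
    ring

lemma P_ne_zero_symm (hd : ∀ v, 0 < G.degree v) {n : ℕ} {x z : V} (h : P G n x z ≠ 0) :
    P G n z x ≠ 0 := by
  intro h0
  have := degree_mul_P hd n x z
  rw [h0, mul_zero, mul_eq_zero] at this
  exact this.elim (fun h' => (hd x).ne' (by exact_mod_cast h')) h

/-- A kernel dominated in support by `P G n`, with one coordinate in a finite set, has finite
support. -/
lemma finite_support_kernel (hd : ∀ v, 0 < G.degree v) {n : ℕ} {A : Set V} (hA : A.Finite)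
    {F : V → V → ℝ} (hF : ∀ x z, F x z ≠ 0 → (x ∈ A ∨ z ∈ A) ∧ P G n x z ≠ 0) :
    (Function.support (Function.uncurry F)).Finite := by
  have h1 : (⋃ x ∈ A, Prod.mk x '' Function.support (P G n x)).Finite :=
    hA.biUnion fun x _ => (finite_support_P n x).image _
  have h2 : (⋃ z ∈ A, (fun x => (x, z)) '' Function.support (P G n z)).Finite :=
    hA.biUnion fun z _ => (finite_support_P n z).image _
  refine (h1.union h2).subset ?_
  rintro ⟨x, z⟩ hxz
  obtain ⟨hx | hz, hP⟩ := hF x z hxz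
  · exact Or.inl (Set.mem_biUnion hx ⟨z, hP, rfl⟩)
  · exact Or.inr (Set.mem_biUnion hz ⟨x, P_ne_zero_symm hd hP, rfl⟩)

lemma summable_kernel (hd : ∀ v, 0 < G.degree v) {n : ℕ} {A : Set V} (hA : A.Finite)
    {F : V → V → ℝ} (hF : ∀ x z, F x z ≠ 0 → (x ∈ A ∨ z ∈ A) ∧ P G n x z ≠ 0) :
    Summable (Function.uncurry F) :=
  summable_of_hasFiniteSupport (finite_support_kernel hd hA hF)

/-- The degree measure is invariant under `P G n`. -/
lemma tsum_degree_mul_tsum_P (hd : ∀ v, 0 < G.degree v) (n : ℕ) {f : V → ℝ}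
    (hf : (Function.support f).Finite) :
    ∑' x, (G.degree x : ℝ) * ∑' z, P G n x z * f z = ∑' z, (G.degree z : ℝ) * f z := by
  simp_rw [← tsum_mul_left]
  rw [← Summable.tsum_comm (f := fun x z => (G.degree x : ℝ) * (P G n x z * f z))
    (summable_kernel (n := n) hd hf fun x z h =>
      ⟨Or.inr fun h0 => h (by simp [h0]), fun h0 => h (by simp [h0])⟩)]
  refine tsum_congr fun z => ?_
  have : ∀ x, (G.degree x : ℝ) * (P G n x z * f z) = (G.degree z * f z) * P G n z x := by
    intro x
    rw [← mul_assoc, degree_mul_P hd]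
    ring
  simp_rw [this, tsum_mul_left, tsum_P hd, mul_one]

lemma tsum_degree_mul_sum_step (hd : ∀ v, 0 < G.degree v) {f : V → ℝ}
    (hf : (Function.support f).Finite) :
    ∑' x, (G.degree x : ℝ) * ∑ z ∈ closedNbhd G x, step G x z * f z
      = ∑' z, (G.degree z : ℝ) * f z := by
  rw [← tsum_degree_mul_tsum_P hd 1 hf]
  simp_rw [P_one, tsum_step_mul]

/-! ### Total variation between nearby starting points -/

lemma summable_abs_P_sub (n : ℕ) (x y : V) : Summable fun z => |P G n x z - P G n y z| :=
  ((summable_P n x).sub (summable_P n y)).abs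

lemma tvDist_le_one (hd : ∀ v, 0 < G.degree v) (n : ℕ) (x y : V) : tvDist G n x y ≤ 1 := by
  have h : ∑' z, |P G n x z - P G n y z| ≤ ∑' z, (P G n x z + P G n y z) :=
    (summable_abs_P_sub n x y).tsum_le_tsum (fun z => by
      have h1 := P_nonneg (G := G) n x z
      have h2 := P_nonneg (G := G) n y z
      rw [abs_le]
      constructor <;> linarith) ((summable_P n x).add (summable_P n y))
  rw [(summable_P n x).tsum_add (summable_P n y), tsum_P hd, tsum_P hd] at h
  unfold tvDist
  linarith

lemma tvDist_nonneg (n : ℕ) (x y : V) : 0 ≤ tvDist G n x y :=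
  mul_nonneg (by norm_num) (tsum_nonneg fun _ => abs_nonneg _)

lemma tvProfile_nonneg (n : ℕ) : 0 ≤ tvProfile G n :=
  Real.iSup_nonneg fun _ => tvDist_nonneg _ _ _

lemma tsum_abs_P_sub_le (hd : ∀ v, 0 < G.degree v) (n : ℕ) {x y : V} (h : y ∈ closedNbhd G x) :
    ∑' z, |P G n x z - P G n y z| ≤ 2 * tvProfile G n := by
  rcases mem_closedNbhd.1 h with rfl | h
  · simpa using tvProfile_nonneg n
  · have hb : BddAbove (Set.range fun e : {e : V × V // G.Adj e.1 e.2} =>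
        tvDist G n e.1.1 e.1.2) :=
      ⟨1, by rintro _ ⟨e, rfl⟩; exact tvDist_le_one hd n _ _⟩
    have : tvDist G n x y ≤ tvProfile G n := le_ciSup hb ⟨(x, y), h⟩
    unfold tvDist at this
    linarith

lemma tsum_abs_P_sub_comm (n : ℕ) (x y : V) :
    ∑' z, |P G n x z - P G n y z| = ∑' z, |P G n y z - P G n x z| :=
  tsum_congr fun _ => abs_sub_comm _ _

/-- One step of the walk moves `P^n(x, ·)` little compared with any neighbour of `x`. -/
lemma tsum_abs_P_sub_succ_le (hd : ∀ v, 0 < G.degree v) (n : ℕ) {x y : V}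
    (h : y ∈ closedNbhd G x) :
    ∑' z, |P G n y z - P G (n + 1) x z| ≤ 4 * tvProfile G n := by
  have hs : ∀ w, Summable fun z => step G x w * |P G n y z - P G n w z| := fun w =>
    (summable_abs_P_sub n y w).mul_left _
  have hle : ∀ z, |P G n y z - P G (n + 1) x z| ≤
      ∑ w ∈ closedNbhd G x, step G x w * |P G n y z - P G n w z| := by
    intro z
    have : P G n y z - P G (n + 1) x z =
        ∑ w ∈ closedNbhd G x, step G x w * (P G n y z - P G n w z) := by
      simp_rw [mul_sub]
      rw [Finset.sum_sub_distrib, ← Finset.sum_mul, sum_step hd, one_mul, P_succ]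
    rw [this]
    refine (Finset.abs_sum_le_sum_abs _ _).trans_eq (Finset.sum_congr rfl fun w _ => ?_)
    rw [abs_mul, abs_of_nonneg (step_nonneg x w)]
  -- The constant 4 comes from going from y to w through x, at a cost of 2 TV_n each way.
  have hmid : ∀ w ∈ closedNbhd G x,
      ∑' z, |P G n y z - P G n w z| ≤ 4 * tvProfile G n := by
    intro w hw
    have h1 := tsum_abs_P_sub_le hd n h
    rw [tsum_abs_P_sub_comm] at h1
    have h2 := tsum_abs_P_sub_le hd n hw
    have h3 := (summable_abs_P_sub n y w).tsum_le_tsum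
      (fun z => abs_sub_le _ (P G n x z) _)
      ((summable_abs_P_sub n y x).add (summable_abs_P_sub n x w))
    rw [(summable_abs_P_sub n y x).tsum_add (summable_abs_P_sub n x w)] at h3
    linarith
  calc ∑' z, |P G n y z - P G (n + 1) x z|
      ≤ ∑' z, ∑ w ∈ closedNbhd G x, step G x w * |P G n y z - P G n w z| :=
        ((summable_P n y).sub (summable_P (n + 1) x)).abs.tsum_le_tsum hle
          (summable_sum fun w _ => hs w)
    _ = ∑ w ∈ closedNbhd G x, step G x w * ∑' z, |P G n y z - P G n w z| := by
        rw [Summable.tsum_finsetSum fun w _ => hs w]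
        simp_rw [tsum_mul_left]
    _ ≤ ∑ w ∈ closedNbhd G x, step G x w * (4 * tvProfile G n) :=
        Finset.sum_le_sum fun w hw => mul_le_mul_of_nonneg_left (hmid w hw) (step_nonneg x w)
    _ = 4 * tvProfile G n := by rw [← Finset.sum_mul, sum_step hd, one_mul]

/-! ### Growth of the entropy -/

lemma entropy_nonneg (hd : ∀ v, 0 < G.degree v) (n : ℕ) (x : V) : 0 ≤ entropy G n x :=
  tsum_nonneg fun y => mul_nonneg (P_nonneg n x y)
    (neg_nonneg.2 (Real.log_nonpos (P_nonneg n x y) (P_le_one hd n x y)))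

lemma entropy_zero (x : V) : entropy G 0 x = 0 := by
  refine (tsum_congr fun y => ?_).trans tsum_zero
  by_cases h : x = y <;> simp [P, h]

/-- A summand `s p log (p / q)` of the mutual information is at most `|p - q|` if `s p ≤ q`. -/
lemma mul_neg_log_le {s p q : ℝ} (hs : 0 ≤ s) (hp : 0 ≤ p) (hq : s * p ≤ q) :
    s * p * -Real.log q ≤ s * (p * -Real.log p) + |p - q| := by
  rcases (mul_nonneg hs hp).eq_or_lt with h | h
  · have : s * (p * -Real.log p) = 0 := by rw [← mul_assoc, ← h, zero_mul]
    rw [this, ← h]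
    simp
  · have hp' : 0 < p := hp.lt_of_ne fun h0 => by simp [← h0] at h
    have hq' : 0 < q := h.trans_le hq
    have hlog : Real.log p - Real.log q ≤ p / q - 1 := by
      rw [← Real.log_div hp'.ne' hq'.ne']
      exact Real.log_le_sub_one_of_pos (by positivity)
    have h1 : s * p * (Real.log p - Real.log q) ≤ s * p * (p / q - 1) :=
      mul_le_mul_of_nonneg_left hlog h.le
    -- The bound log t ≤ t - 1 alone gives a chi-square term; the factor s p / q ≤ 1 reduces it to
    -- an L¹ distance.
    have h2 : s * p * (p / q - 1) = (s * p / q) * (p - q) := by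
      field_simp
    have h3 : (s * p / q) * (p - q) ≤ |p - q| := by
      have h4 : s * p / q ≤ 1 := (div_le_one hq').2 hq
      calc (s * p / q) * (p - q) ≤ (s * p / q) * |p - q| :=
            mul_le_mul_of_nonneg_left (le_abs_self _) (by positivity)
        _ ≤ 1 * |p - q| := mul_le_mul_of_nonneg_right h4 (abs_nonneg _)
        _ = |p - q| := one_mul _
    nlinarith

/-- Condition on the first step: the excess of the entropy of a mixture over the mean entropy is the
mutual information of the first step and the endpoint. `mul_neg_log_le` bounds it by L¹ distances
without the step weights, hence the factor M + 1 counting a closed neighbourhood. -/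
lemma entropy_succ_le (hd : ∀ v, 0 < G.degree v) {M : ℕ} (hdeg : ∀ v, G.degree v ≤ M)
    (n : ℕ) (x : V) :
    entropy G (n + 1) x ≤ ∑ y ∈ closedNbhd G x, step G x y * entropy G n y
      + (M + 1) * (4 * tvProfile G n) := by
  have hs1 : ∀ y, Summable fun z => step G x y * (P G n y z * -Real.log (P G n y z)) := fun y =>
    (summable_P_mul n y _).mul_left _
  have hs2 : ∀ y, Summable fun z => |P G n y z - P G (n + 1) x z| := fun y =>
    ((summable_P n y).sub (summable_P (n + 1) x)).abs
  have hle : ∀ z, P G (n + 1) x z * -Real.log (P G (n + 1) x z) ≤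
      ∑ y ∈ closedNbhd G x, (step G x y * (P G n y z * -Real.log (P G n y z))
        + |P G n y z - P G (n + 1) x z|) := by
    intro z
    nth_rewrite 1 [P_succ]
    rw [Finset.sum_mul]
    refine Finset.sum_le_sum fun y hy => mul_neg_log_le (step_nonneg x y) (P_nonneg n y z) ?_
    rw [P_succ]
    exact Finset.single_le_sum
      (f := fun y => step G x y * P G n y z)
      (fun w _ => mul_nonneg (step_nonneg x w) (P_nonneg n w z)) hy
  calc entropy G (n + 1) x
      ≤ ∑' z, ∑ y ∈ closedNbhd G x, (step G x y * (P G n y z * -Real.log (P G n y z))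
        + |P G n y z - P G (n + 1) x z|) :=
        (summable_P_mul (n + 1) x _).tsum_le_tsum hle
          (summable_sum fun y _ => (hs1 y).add (hs2 y))
    _ = ∑ y ∈ closedNbhd G x, step G x y * entropy G n y
        + ∑ y ∈ closedNbhd G x, ∑' z, |P G n y z - P G (n + 1) x z| := by
        rw [Summable.tsum_finsetSum fun y _ => (hs1 y).add (hs2 y), ← Finset.sum_add_distrib]
        refine Finset.sum_congr rfl fun y _ => ?_
        rw [(hs1 y).tsum_add (hs2 y), tsum_mul_left, entropy]
    _ ≤ _ := by
        gcongr
        refine (Finset.sum_le_card_nsmul _ _ _ fun y hy => tsum_abs_P_sub_succ_le hd n hy).trans ?_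
        rw [nsmul_eq_mul]
        refine mul_le_mul_of_nonneg_right ?_ (by have := tvProfile_nonneg (G := G) n; positivity)
        exact_mod_cast card_closedNbhd_le hdeg x

/-- The entropy of the walk is controlled by the sum of the total variation profile. -/
lemma entropy_le_sum_tvProfile (hd : ∀ v, 0 < G.degree v) {M : ℕ} (hdeg : ∀ v, G.degree v ≤ M)
    (n : ℕ) (x : V) :
    entropy G n x ≤ 4 * (M + 1) * ∑ k ∈ Finset.range n, tvProfile G k := by
  induction n generalizing x with
  | zero => simp [entropy_zero]
  | succ n ih =>
    refine (entropy_succ_le hd hdeg n x).trans ?_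
    have : ∑ y ∈ closedNbhd G x, step G x y * entropy G n y ≤
        ∑ y ∈ closedNbhd G x, step G x y *
          (4 * (M + 1) * ∑ k ∈ Finset.range n, tvProfile G k) :=
      Finset.sum_le_sum fun y _ => mul_le_mul_of_nonneg_left (ih y) (step_nonneg x y)
    rw [← Finset.sum_mul, sum_step hd, one_mul] at this
    rw [Finset.sum_range_succ]
    linarith

/-- A real supremum of an unbounded family is 0 by convention, so boundedness must be proved; it
comes from the total variation bound on the entropy, uniformly in the starting point. -/
lemma entropy_le_entropyProfile (hd : ∀ v, 0 < G.degree v) {M : ℕ}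
    (hdeg : ∀ v, G.degree v ≤ M) (n : ℕ) (x : V) : entropy G n x ≤ entropyProfile G n := by
  set B : ℝ := 4 * (M + 1) * ∑ k ∈ Finset.range n, tvProfile G k
  have hB : ∀ y : V, ∀ m : Fin (n + 1), entropy G m y ≤ B := fun y m =>
    (entropy_le_sum_tvProfile hd hdeg m y).trans <| by
      refine mul_le_mul_of_nonneg_left ?_ (by positivity)
      exact Finset.sum_le_sum_of_subset_of_nonneg
        (Finset.range_subset_range.2 (Nat.lt_succ_iff.1 m.2)) fun k _ _ => tvProfile_nonneg k
  have h1 : entropy G n x ≤ ⨆ m : Fin (n + 1), entropy G m x :=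
    le_ciSup (f := fun m : Fin (n + 1) => entropy G m x)
      ⟨B, by rintro _ ⟨m, rfl⟩; exact hB x m⟩ (Fin.last n)
  exact h1.trans <| le_ciSup (f := fun y : V => ⨆ m : Fin (n + 1), entropy G m y)
    ⟨B, by rintro _ ⟨y, rfl⟩; exact ciSup_le (hB y)⟩ x

/-- If the total variation profile tends to zero then the entropy grows sublinearly. -/
lemma tendsto_entropy_div (hd : ∀ v, 0 < G.degree v) {M : ℕ} (hdeg : ∀ v, G.degree v ≤ M)
    (hTV : Tendsto (tvProfile G) atTop (nhds 0)) (x : V) :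
    Tendsto (fun n : ℕ => (n : ℝ)⁻¹ * entropy G n x) atTop (nhds 0) := by
  have h : Tendsto (fun n : ℕ => 4 * ((M : ℝ) + 1) *
      ((n : ℝ)⁻¹ * ∑ k ∈ Finset.range n, tvProfile G k)) atTop (nhds 0) := by
    simpa using hTV.cesaro.const_mul (4 * ((M : ℝ) + 1))
  refine squeeze_zero (fun n => mul_nonneg (by positivity) (entropy_nonneg hd n x))
    (fun n => ?_) h
  calc (n : ℝ)⁻¹ * entropy G n x
      ≤ (n : ℝ)⁻¹ * (4 * (M + 1) * ∑ k ∈ Finset.range n, tvProfile G k) :=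
        mul_le_mul_of_nonneg_left (entropy_le_sum_tvProfile hd hdeg n x) (by positivity)
    _ = _ := by ring

/-! ### Entropy production and almost invariant functions -/

lemma finite_support_P_left (hd : ∀ v, 0 < G.degree v) (n : ℕ) (o : V) :
    (Function.support fun x => P G n x o).Finite :=
  (finite_support_P n o).subset fun _ hx => P_ne_zero_symm hd hx

lemma tsum_degree_mul_P (hd : ∀ v, 0 < G.degree v) (n : ℕ) (o : V) :
    ∑' x, (G.degree x : ℝ) * P G n x o = G.degree o := by
  simp_rw [fun x => degree_mul_P hd n x o, tsum_mul_left, tsum_P hd, mul_one]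

lemma summable_degree_mul {f : V → ℝ} (hf : (Function.support f).Finite) :
    Summable fun x => (G.degree x : ℝ) * f x :=
  summable_of_hasFiniteSupport (hf.subset fun _ hx => right_ne_zero_of_mul hx)

/-- A quantitative form of the strict convexity of `t ↦ t log t`. -/
lemma mul_abs_sub_le_log {a b s : ℝ} (ha : 0 ≤ a) (hb : 0 ≤ b)
    (hab : b = 0 → a = 0) :
    s * |a - b| ≤ a * Real.log a - a * Real.log b - a + b + s ^ 2 * (a + b) / 2 := by
  rcases hb.eq_or_lt with rfl | hb'
  · simp [hab rfl]
  rcases ha.eq_or_lt with rfl | ha'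
  · simp only [zero_sub, abs_neg, abs_of_pos hb']
    nlinarith [mul_nonneg hb (sq_nonneg (s - 1))]
  obtain ⟨p, hp, rfl⟩ : ∃ p, 0 < p ∧ a = p ^ 2 :=
    ⟨√a, Real.sqrt_pos.2 ha', (Real.sq_sqrt ha).symm⟩
  obtain ⟨q, hq, rfl⟩ : ∃ q, 0 < q ∧ b = q ^ 2 :=
    ⟨√b, Real.sqrt_pos.2 hb', (Real.sq_sqrt hb).symm⟩
  -- Square roots give the Hellinger bound a log(a/b) - a + b ≥ (√a - √b)²; the linear term in s
  -- then follows from the arithmetic-geometric mean inequality.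
  have hlog : Real.log q - Real.log p ≤ q / p - 1 := by
    rw [← Real.log_div hq.ne' hp.ne']
    exact Real.log_le_sub_one_of_pos (by positivity)
  have h1 : p ^ 2 * (Real.log q - Real.log p) ≤ p * q - p ^ 2 := by
    calc p ^ 2 * (Real.log q - Real.log p) ≤ p ^ 2 * (q / p - 1) :=
          mul_le_mul_of_nonneg_left hlog (by positivity)
      _ = p * q - p ^ 2 := by field_simp
  have h2 : p ^ 2 * Real.log (p ^ 2) - p ^ 2 * Real.log (q ^ 2) =
      -2 * (p ^ 2 * (Real.log q - Real.log p)) := by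
    rw [Real.log_pow, Real.log_pow]
    push_cast
    ring
  have h3 : s * |p ^ 2 - q ^ 2| ≤ (p - q) ^ 2 + s ^ 2 * (p ^ 2 + q ^ 2) / 2 := by
    have h4 : p ^ 2 - q ^ 2 = (p - q) * (p + q) := by ring
    rw [h4, abs_mul, abs_of_pos (by positivity : 0 < p + q)]
    have h5 := sq_nonneg (|p - q| - s * (p + q) / 2)
    have h6 := sq_abs (p - q)
    nlinarith [mul_nonneg (sq_nonneg s) (sq_nonneg (p - q))]
  nlinarith

variable (G) in
/-- The entropy, with respect to the degree measure, of the function `x ↦ P^n(x, o)`. -/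
def columnEntropy (n : ℕ) (o : V) : ℝ := ∑' x, (G.degree x : ℝ) * Real.negMulLog (P G n x o)

lemma finite_support_negMulLog_P (hd : ∀ v, 0 < G.degree v) (n : ℕ) (o : V) :
    (Function.support fun x => Real.negMulLog (P G n x o)).Finite :=
  (finite_support_P_left hd n o).subset fun x hx h => hx (by simp [h])

lemma columnEntropy_nonneg (hd : ∀ v, 0 < G.degree v) (n : ℕ) (o : V) :
    0 ≤ columnEntropy G n o :=
  tsum_nonneg fun x => mul_nonneg (Nat.cast_nonneg _)
    (Real.negMulLog_nonneg (P_nonneg n x o) (P_le_one hd n x o))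

/-- By reversibility deg x · P^n(x,o) = deg o · P^n(o,x), so row and column entropies differ only by
logarithms of degrees. Columns are used because P^{n+1}(·,o) is the one-step average of P^n(·,o), so
that concavity acts pointwise. -/
lemma columnEntropy_le (hd : ∀ v, 0 < G.degree v) {M : ℕ} (hdeg : ∀ v, G.degree v ≤ M)
    (n : ℕ) (o : V) :
    columnEntropy G n o ≤ G.degree o * (entropy G n o + Real.log M) := by
  have hs := summable_P_mul (G := G) n o fun z => -Real.log (P G n o z)
  have hle : ∀ x, (G.degree x : ℝ) * Real.negMulLog (P G n x o) ≤
      G.degree o * (P G n o x * -Real.log (P G n o x) + P G n o x * Real.log M) := by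
    intro x
    rcases (P_nonneg (G := G) n x o).eq_or_lt with h | h
    · have h0 : P G n o x = 0 := by
        by_contra h0
        exact P_ne_zero_symm hd h0 h.symm
      simp [← h, h0]
    · have h0 : 0 < P G n o x := (P_nonneg n o x).lt_of_ne' (P_ne_zero_symm hd h.ne')
      have hx : (0 : ℝ) < G.degree x := by exact_mod_cast hd x
      have ho : (0 : ℝ) < G.degree o := by exact_mod_cast hd o
      have ho' : (0 : ℝ) ≤ Real.log (G.degree o) := Real.log_natCast_nonneg _
      have hxM : Real.log (G.degree x) ≤ Real.log M :=
        Real.log_le_log hx (by exact_mod_cast hdeg x)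
      have hlog : Real.log (G.degree x) + Real.log (P G n x o) =
          Real.log (G.degree o) + Real.log (P G n o x) := by
        rw [← Real.log_mul hx.ne' h.ne', degree_mul_P hd, Real.log_mul ho.ne' h0.ne']
      have : (G.degree x : ℝ) * Real.negMulLog (P G n x o) =
          G.degree o * (P G n o x * -Real.log (P G n x o)) := by
        rw [Real.negMulLog, ← mul_assoc, ← mul_assoc, ← degree_mul_P hd]
        ring
      rw [this, ← mul_add]
      refine mul_le_mul_of_nonneg_left (mul_le_mul_of_nonneg_left ?_ h0.le) ho.le
      linarith
  calc columnEntropy G n o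
      ≤ ∑' x, (G.degree o : ℝ) *
          (P G n o x * -Real.log (P G n o x) + P G n o x * Real.log M) :=
        (summable_degree_mul (finite_support_negMulLog_P hd n o)).tsum_le_tsum hle
          ((hs.add ((summable_P n o).mul_right _)).mul_left _)
    _ = _ := by
        rw [tsum_mul_left, hs.tsum_add ((summable_P n o).mul_right _), tsum_mul_right,
          tsum_P hd, one_mul, entropy]

/-- The local entropy production dominates the oscillation of the heat kernel. -/
lemma mul_sum_abs_sub_succ_le (hd : ∀ v, 0 < G.degree v) (n : ℕ) (o y : V) (s : ℝ) :
    s * ∑ x ∈ closedNbhd G y, step G y x * |P G n x o - P G (n + 1) y o| ≤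
      Real.negMulLog (P G (n + 1) y o)
        - ∑ x ∈ closedNbhd G y, step G y x * Real.negMulLog (P G n x o)
        + s ^ 2 * P G (n + 1) y o := by
  set b := P G (n + 1) y o with hb
  have hbs : ∑ x ∈ closedNbhd G y, step G y x * P G n x o = b := by rw [hb, P_succ]
  have hle : ∀ x ∈ closedNbhd G y, step G y x * (s * |P G n x o - b|) ≤
      step G y x * (P G n x o * Real.log (P G n x o) - P G n x o * Real.log b - P G n x o + b
        + s ^ 2 * (P G n x o + b) / 2) := by
    intro x hx
    by_cases h0 : step G y x = 0
    · simp [h0]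
    refine mul_le_mul_of_nonneg_left (mul_abs_sub_le_log (P_nonneg n x o)
      (P_nonneg (n + 1) y o) fun hb0 => ?_) (step_nonneg y x)
    rw [hb0] at hbs
    exact (mul_eq_zero.1 ((Finset.sum_eq_zero_iff_of_nonneg fun w _ =>
      mul_nonneg (step_nonneg y w) (P_nonneg n w o)).1 hbs x hx)).resolve_left h0
  have hsum := Finset.sum_le_sum hle
  have hL : ∑ x ∈ closedNbhd G y, step G y x * (s * |P G n x o - b|) =
      s * ∑ x ∈ closedNbhd G y, step G y x * |P G n x o - b| := by
    rw [Finset.mul_sum]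
    exact Finset.sum_congr rfl fun x _ => by ring
  have hR : ∑ x ∈ closedNbhd G y, step G y x *
      (P G n x o * Real.log (P G n x o) - P G n x o * Real.log b - P G n x o + b
        + s ^ 2 * (P G n x o + b) / 2) =
      -∑ x ∈ closedNbhd G y, step G y x * Real.negMulLog (P G n x o)
        + (∑ x ∈ closedNbhd G y, step G y x * P G n x o) * (-Real.log b - 1 + s ^ 2 / 2)
        + (∑ x ∈ closedNbhd G y, step G y x) * (b + s ^ 2 * b / 2) := by
    rw [Finset.sum_mul, Finset.sum_mul, ← Finset.sum_neg_distrib, ← Finset.sum_add_distrib,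
      ← Finset.sum_add_distrib]
    refine Finset.sum_congr rfl fun x _ => ?_
    rw [Real.negMulLog]
    ring
  rw [hL, hR, hbs, sum_step hd] at hsum
  refine hsum.trans_eq ?_
  rw [Real.negMulLog]
  ring

lemma finite_support_sum_step (hd : ∀ v, 0 < G.degree v) {A : Set V} (hA : A.Finite)
    {F : V → V → ℝ} (hF : ∀ x z, F x z ≠ 0 → x ∈ A ∨ z ∈ A) :
    (Function.support fun x => ∑ z ∈ closedNbhd G x, step G x z * F x z).Finite := by
  have := finite_support_kernel (n := 1) hd hA (F := fun x z => step G x z * F x z)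
    fun x z h => ⟨hF x z (right_ne_zero_of_mul h), by
      rw [P_one]
      exact left_ne_zero_of_mul h⟩
  refine (this.image Prod.fst).subset fun x hx => ?_
  obtain ⟨z, -, hz⟩ := Finset.exists_ne_zero_of_sum_ne_zero hx
  exact ⟨(x, z), hz, rfl⟩

variable (G) in
/-- The `L¹` oscillation of a function along one step of the walk. -/
def oscillation (u : V → ℝ) : ℝ :=
  ∑' x, (G.degree x : ℝ) * ∑ y ∈ closedNbhd G x, step G x y * |u x - u y|

lemma finite_support_sum_step_abs (hd : ∀ v, 0 < G.degree v) {u : V → ℝ}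
    (hu : (Function.support u).Finite) :
    (Function.support fun x => ∑ y ∈ closedNbhd G x, step G x y * |u x - u y|).Finite :=
  finite_support_sum_step hd hu fun x z h => by
    by_contra! h'
    simp only [Function.mem_support, not_not] at h'
    exact h (by simp [h'.1, h'.2])

/-- Integrate `mul_sum_abs_sub_succ_le` against the degree measure: by invariance the averaged term
becomes the column entropy at time n. -/
lemma mul_oscillation_P_le (hd : ∀ v, 0 < G.degree v) (n : ℕ) (o : V) {s : ℝ} (hs : 0 ≤ s) :
    s * oscillation G (fun x => P G n x o) ≤
      3 * (columnEntropy G (n + 1) o - columnEntropy G n o + s ^ 2 * G.degree o) := by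
  have hf0 := finite_support_P_left hd n o
  have hf1 := finite_support_P_left hd (n + 1) o
  have hA : (Function.support fun y =>
      ∑ x ∈ closedNbhd G y, step G y x * |P G n x o - P G (n + 1) y o|).Finite :=
    finite_support_sum_step hd (hf0.union hf1) fun x z h => by
      by_contra! h'
      simp only [Set.mem_union, Function.mem_support, not_or, not_not] at h'
      exact h (by simp [h'.1.2, h'.2.1])
  have hN := finite_support_negMulLog_P hd n o
  have hN1 := finite_support_negMulLog_P hd (n + 1) o
  have hS : (Function.support fun y =>
      ∑ x ∈ closedNbhd G y, step G y x * Real.negMulLog (P G n x o)).Finite :=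
    finite_support_sum_step hd hN (F := fun _ x => Real.negMulLog (P G n x o))
      fun x z h => Or.inr h
  have h1 : s * ∑' y, (G.degree y : ℝ) *
      ∑ x ∈ closedNbhd G y, step G y x * |P G n x o - P G (n + 1) y o| ≤
      columnEntropy G (n + 1) o - columnEntropy G n o + s ^ 2 * G.degree o := by
    calc _ = ∑' y, s * ((G.degree y : ℝ) *
          ∑ x ∈ closedNbhd G y, step G y x * |P G n x o - P G (n + 1) y o|) := tsum_mul_left.symm
      _ ≤ ∑' y, ((G.degree y : ℝ) * Real.negMulLog (P G (n + 1) y o)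
          - (G.degree y : ℝ) * ∑ x ∈ closedNbhd G y, step G y x * Real.negMulLog (P G n x o)
          + s ^ 2 * ((G.degree y : ℝ) * P G (n + 1) y o)) := by
          refine ((summable_degree_mul hA).mul_left _).tsum_le_tsum (fun y => ?_)
            (((summable_degree_mul hN1).sub (summable_degree_mul hS)).add
              ((summable_degree_mul hf1).mul_left _))
          have := mul_le_mul_of_nonneg_left (mul_sum_abs_sub_succ_le hd n o y s)
            (Nat.cast_nonneg (α := ℝ) (G.degree y))
          linarith
      _ = _ := by
          rw [((summable_degree_mul hN1).sub (summable_degree_mul hS)).tsum_add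
              ((summable_degree_mul hf1).mul_left _),
            (summable_degree_mul hN1).tsum_sub (summable_degree_mul hS), tsum_mul_left,
            tsum_degree_mul_P hd, tsum_degree_mul_sum_step hd hN]
          rfl
  have h2 : oscillation G (fun x => P G n x o) ≤ 3 * ∑' y, (G.degree y : ℝ) *
      ∑ x ∈ closedNbhd G y, step G y x * |P G n x o - P G (n + 1) y o| := by
    rw [← tsum_mul_left]
    refine (summable_degree_mul (finite_support_sum_step_abs hd hf0)).tsum_le_tsum (fun y => ?_)
      ((summable_degree_mul hA).mul_left _)
    rw [mul_left_comm]
    refine mul_le_mul_of_nonneg_left ?_ (Nat.cast_nonneg _)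
    set b := P G (n + 1) y o
    have h3 : ∑ x ∈ closedNbhd G y, step G y x * |P G n y o - P G n x o| ≤
        ∑ x ∈ closedNbhd G y, step G y x * |P G n x o - b| + |P G n y o - b| := by
      have : |P G n y o - b| = ∑ x ∈ closedNbhd G y, step G y x * |P G n y o - b| := by
        rw [← Finset.sum_mul, sum_step hd, one_mul]
      rw [this, ← Finset.sum_add_distrib]
      refine Finset.sum_le_sum fun x _ => ?_
      rw [← mul_add]
      refine mul_le_mul_of_nonneg_left ?_ (step_nonneg y x)
      rw [add_comm, abs_sub_comm (P G n x o)]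
      exact abs_sub_le _ _ _
    -- Laziness: the holding probability 1/2 bounds the deviation at y itself by twice the mean
    -- deviation from b, whence the factor 3.
    have h4 : step G y y * |P G n y o - b| ≤
        ∑ x ∈ closedNbhd G y, step G y x * |P G n x o - b| :=
      Finset.single_le_sum (f := fun x => step G y x * |P G n x o - b|)
        (fun x _ => mul_nonneg (step_nonneg y x) (abs_nonneg _)) (self_mem_closedNbhd y)
    rw [step_self] at h4
    linarith
  nlinarith [mul_le_mul_of_nonneg_left h2 hs]

/-- If the total variation profile tends to zero, there are almost invariant functions. -/
lemma exists_oscillation_le [Nonempty V] (hd : ∀ v, 0 < G.degree v) {M : ℕ}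
    (hdeg : ∀ v, G.degree v ≤ M) (hTV : Tendsto (tvProfile G) atTop (nhds 0)) {ε : ℝ}
    (hε : 0 < ε) :
    ∃ u : V → ℝ, (∀ x, 0 ≤ u x) ∧ (Function.support u).Finite ∧
      1 ≤ ∑' x, (G.degree x : ℝ) * u x ∧ oscillation G u ≤ ε := by
  obtain ⟨o⟩ := ‹Nonempty V›
  have ho : (0 : ℝ) < G.degree o := by exact_mod_cast hd o
  set D : ℝ := (G.degree o : ℝ)
  obtain ⟨s, hs, hsε⟩ : ∃ s : ℝ, 0 < s ∧ 3 * (1 + D) * s ≤ ε :=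
    ⟨ε / (3 * (1 + D)), by positivity, by field_simp; exact le_rfl⟩
  -- Otherwise every increment exceeds s², and the column entropy grows linearly, against
  -- `tendsto_entropy_div`.
  obtain ⟨n, hn⟩ : ∃ n, columnEntropy G (n + 1) o - columnEntropy G n o ≤ s ^ 2 := by
    by_contra! h
    have hgrow : ∀ n : ℕ, n * s ^ 2 ≤ columnEntropy G n o := by
      intro n
      induction n with
      | zero => simpa using columnEntropy_nonneg hd 0 o
      | succ n ih =>
        have := h n
        push_cast
        linarith
    have hlim : Tendsto (fun n : ℕ => D * ((n : ℝ)⁻¹ * entropy G n o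
        + (n : ℝ)⁻¹ * Real.log M)) atTop (nhds 0) := by
      simpa using ((tendsto_entropy_div hd hdeg hTV o).add
        ((tendsto_inv_atTop_nhds_zero_nat (𝕜 := ℝ)).mul_const (Real.log M))).const_mul D
    obtain ⟨n, hn, hn0⟩ :=
      ((hlim.eventually_lt_const (by positivity : 0 < s ^ 2)).and (eventually_gt_atTop 0)).exists
    have hn' : (0 : ℝ) < n := by exact_mod_cast hn0
    have h1 := (hgrow n).trans (columnEntropy_le hd hdeg n o)
    have h2 : D * ((n : ℝ)⁻¹ * entropy G n o + (n : ℝ)⁻¹ * Real.log M) =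
        (n : ℝ)⁻¹ * (D * (entropy G n o + Real.log M)) := by ring
    rw [h2, inv_mul_lt_iff₀ hn'] at hn
    exact absurd h1 (not_le.2 hn)
  refine ⟨fun x => P G n x o, fun x => P_nonneg n x o, finite_support_P_left hd n o, ?_, ?_⟩
  · rw [tsum_degree_mul_P hd]
    exact_mod_cast hd o
  · have h := mul_oscillation_P_le hd n o hs.le
    have h' : s * oscillation G (fun x => P G n x o) ≤ s * (3 * (1 + D) * s) := by
      refine h.trans ?_
      nlinarith
    exact (le_of_mul_le_mul_left h' hs).trans hsε

lemma finite_support_tsum_P_abs (hd : ∀ v, 0 < G.degree v) (n : ℕ) {u : V → ℝ}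
    (hu : (Function.support u).Finite) :
    (Function.support fun x => ∑' z, P G n x z * |u x - u z|).Finite := by
  have := finite_support_kernel (n := n) hd hu (F := fun x z => P G n x z * |u x - u z|)
    fun x z h => ⟨by
      by_contra! h'
      simp only [Function.mem_support, not_not] at h'
      exact h (by simp [h'.1, h'.2]), left_ne_zero_of_mul h⟩
  refine (this.image Prod.fst).subset fun x hx => ?_
  obtain ⟨z, hz⟩ : ∃ z, P G n x z * |u x - u z| ≠ 0 := by
    by_contra! h
    exact hx (by simp [h])
  exact ⟨(x, z), hz, rfl⟩

/-- The oscillation along `n` steps is at most `n` times the oscillation along one step. -/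
lemma tsum_P_abs_sub_le (hd : ∀ v, 0 < G.degree v) {u : V → ℝ}
    (hu : (Function.support u).Finite) (n : ℕ) :
    ∑' x, (G.degree x : ℝ) * ∑' z, P G n x z * |u x - u z| ≤ n * oscillation G u := by
  induction n with
  | zero =>
    refine ((tsum_congr fun x => ?_).trans tsum_zero).le.trans (by simp)
    have : ∀ z, P G 0 x z * |u x - u z| = 0 := fun z => by
      by_cases h : x = z <;> simp [P, h]
    simp [this]
  | succ n ih =>
    have hf1 := finite_support_sum_step_abs hd hu
    have hfn := finite_support_tsum_P_abs hd n hu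
    have hS : (Function.support fun x => ∑ y ∈ closedNbhd G x, step G x y *
        ∑' z, P G n y z * |u y - u z|).Finite :=
      finite_support_sum_step hd hfn (F := fun _ y => ∑' z, P G n y z * |u y - u z|)
        fun x z h => Or.inr h
    -- Triangle inequality through the position y after one step; invariance of the degree measure
    -- then removes the average over y.
    have hle : ∀ x, ∑' z, P G (n + 1) x z * |u x - u z| ≤
        ∑ y ∈ closedNbhd G x, step G x y * |u x - u y|
          + ∑ y ∈ closedNbhd G x, step G x y * ∑' z, P G n y z * |u y - u z| := by
      intro x
      have hs : ∀ y, Summable fun z => P G n y z * (|u x - u y| + |u y - u z|) := fun y =>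
        summable_P_mul n y _
      calc ∑' z, P G (n + 1) x z * |u x - u z|
          ≤ ∑' z, ∑ y ∈ closedNbhd G x,
              step G x y * (P G n y z * (|u x - u y| + |u y - u z|)) := by
            refine (summable_P_mul (n + 1) x _).tsum_le_tsum (fun z => ?_)
              (summable_sum fun y _ => (hs y).mul_left _)
            rw [P_succ, Finset.sum_mul]
            refine Finset.sum_le_sum fun y _ => ?_
            rw [mul_assoc]
            exact mul_le_mul_of_nonneg_left (mul_le_mul_of_nonneg_left (abs_sub_le _ _ _)
              (P_nonneg n y z)) (step_nonneg x y)
        _ = _ := by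
            rw [Summable.tsum_finsetSum fun y _ => (hs y).mul_left _, ← Finset.sum_add_distrib]
            refine Finset.sum_congr rfl fun y _ => ?_
            rw [tsum_mul_left, ← mul_add]
            simp_rw [mul_add]
            rw [((summable_P n y).mul_right _).tsum_add (summable_P_mul n y _), tsum_mul_right,
              tsum_P hd, one_mul, mul_add]
    calc ∑' x, (G.degree x : ℝ) * ∑' z, P G (n + 1) x z * |u x - u z|
        ≤ ∑' x, ((G.degree x : ℝ) * ∑ y ∈ closedNbhd G x, step G x y * |u x - u y|
          + (G.degree x : ℝ) * ∑ y ∈ closedNbhd G x, step G x y *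
              ∑' z, P G n y z * |u y - u z|) := by
          refine (summable_degree_mul (finite_support_tsum_P_abs hd (n + 1) hu)).tsum_le_tsum
            (fun x => ?_) ((summable_degree_mul hf1).add (summable_degree_mul hS))
          rw [← mul_add]
          exact mul_le_mul_of_nonneg_left (hle x) (Nat.cast_nonneg _)
      _ = oscillation G u + ∑' x, (G.degree x : ℝ) * ∑' z, P G n x z * |u x - u z| := by
          rw [(summable_degree_mul hf1).tsum_add (summable_degree_mul hS),
            tsum_degree_mul_sum_step hd hfn, oscillation]
      _ ≤ _ := by
          push_cast
          linarith

/-! ### Isoperimetry and the coarea inequality -/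

open Classical in
lemma ncard_edgeBoundary_le (W : Finset V) :
    (edgeBoundary G W).ncard ≤ ∑ x ∈ W, {y ∈ G.neighborFinset x | y ∉ W}.card := by
  rw [← Finset.card_sigma]
  refine (Set.ncard_le_ncard (t := ((W.sigma fun x => {y ∈ G.neighborFinset x | y ∉ W}).image
    fun e => s(e.1, e.2) : Finset (Sym2 V))) ?_ (Finset.finite_toSet _)).trans ?_
  · rintro e ⟨he, x, hx, y, hy, rfl⟩
    simp only [Finset.coe_image, Set.mem_image, Finset.mem_coe, Finset.mem_sigma,
      Finset.mem_filter, SimpleGraph.mem_neighborFinset]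
    exact ⟨⟨x, y⟩, ⟨hx, he, hy⟩, rfl⟩
  · rw [Set.ncard_coe_finset]
    exact Finset.card_image_le

lemma isoProfile_nonneg (N : ℕ) : 0 ≤ isoProfile G N :=
  Real.sInf_nonneg <| by
    rintro _ ⟨W, -, -, rfl⟩
    positivity

lemma vol_eq_sum (W : Finset V) : (vol G W : ℝ) = ∑ x ∈ W, (G.degree x : ℝ) := by
  simp [vol]

lemma isoProfile_mul_vol_le (hd : ∀ v, 0 < G.degree v) {N : ℕ} {W : Finset V}
    (hW : W.Nonempty) (hN : vol G W ≤ N) :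
    isoProfile G N * vol G W ≤ (edgeBoundary G W).ncard := by
  have hpos : (0 : ℝ) < vol G W := by
    exact_mod_cast Finset.sum_pos (fun v _ => hd v) hW
  rw [← le_div_iff₀ hpos]
  exact csInf_le ⟨0, by rintro _ ⟨W, -, -, rfl⟩; positivity⟩ ⟨W, hW, hN, rfl⟩

/-- Coarea: an isoperimetric inequality for subsets of `S` gives an `L¹` Sobolev inequality for
functions supported on `S`. -/
lemma mul_sum_le_sum_gradient {φ : ℝ} (S : Finset V) (f : V → ℝ) (hpos : ∀ x ∈ S, 0 < f x)
    (hzero : ∀ x ∉ S, f x = 0)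
    (hφ : ∀ W ⊆ S, W.Nonempty → φ * vol G W ≤ (edgeBoundary G W).ncard) :
    φ * ∑ x ∈ S, (G.degree x : ℝ) * f x ≤
      ∑ x ∈ S, ∑ y ∈ G.neighborFinset x, max (f x - f y) 0 := by
  classical
  induction S using Finset.strongInduction generalizing f with
  | H S ih =>
    rcases S.eq_empty_or_nonempty with rfl | hS
    · simp
    -- Peel off the lowest layer: subtracting the minimum m on S removes m · vol S on the left. On
    -- the right, edges inside S keep their difference and each edge leaving S loses exactly m.
    obtain ⟨x₀, hx₀, hmin⟩ := S.exists_min_image f hS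
    set m := f x₀
    have hm : 0 < m := hpos x₀ hx₀
    set S' := S.filter fun x => m < f x with hS'
    have hsub : S' ⊂ S := Finset.filter_ssubset.2 ⟨x₀, hx₀, lt_irrefl m⟩
    set f' : V → ℝ := fun x => if x ∈ S then f x - m else 0 with hf'
    have hf'nonneg : ∀ x, 0 ≤ f' x := by
      intro x
      simp only [hf']
      split_ifs with h
      · linarith [hmin x h]
      · exact le_rfl
    have hf'zero : ∀ x ∉ S', f' x = 0 := by
      intro x hx
      simp only [hf']
      split_ifs with h
      · have : ¬ m < f x := fun h' => hx (Finset.mem_filter.2 ⟨h, h'⟩)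
        linarith [hmin x h]
      · rfl
    have hind := ih S' hsub f' (fun x hx => by
        rw [hS', Finset.mem_filter] at hx
        simp only [hf', hx.1, if_true]
        linarith [hx.2]) hf'zero fun W hW => hφ W (hW.trans hsub.1)
    have hS1 : ∑ x ∈ S, (G.degree x : ℝ) * f x =
        m * vol G S + ∑ x ∈ S', (G.degree x : ℝ) * f' x := by
      rw [Finset.sum_subset hsub.1 fun x _ hx => by rw [hf'zero x hx, mul_zero], vol_eq_sum,
        Finset.mul_sum, ← Finset.sum_add_distrib]
      refine Finset.sum_congr rfl fun x hx => ?_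
      simp only [hf', hx, if_true]
      ring
    have hS2 : ∑ x ∈ S, ∑ y ∈ G.neighborFinset x, max (f x - f y) 0 =
        m * (∑ x ∈ S, {y ∈ G.neighborFinset x | y ∉ S}.card : ℕ)
          + ∑ x ∈ S', ∑ y ∈ G.neighborFinset x, max (f' x - f' y) 0 := by
      rw [Finset.sum_subset hsub.1 fun x _ hx => Finset.sum_eq_zero fun y _ => by
        rw [hf'zero x hx, max_eq_right (by linarith [hf'nonneg y])]]
      push_cast
      rw [Finset.mul_sum, ← Finset.sum_add_distrib]
      refine Finset.sum_congr rfl fun x hx => ?_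
      rw [Finset.card_filter]
      push_cast
      rw [Finset.mul_sum, ← Finset.sum_add_distrib]
      refine Finset.sum_congr rfl fun y _ => ?_
      have := hmin x hx
      by_cases hy : y ∈ S
      · simp [hf', hx, hy]
      · simp only [hf', hx, hy, hzero y hy, if_true, if_false, not_false_eq_true]
        rw [max_eq_left (by linarith), max_eq_left (by linarith)]
        ring
    have hbd : φ * vol G S ≤ (∑ x ∈ S, {y ∈ G.neighborFinset x | y ∉ S}.card : ℕ) :=
      (hφ S subset_rfl hS).trans (by exact_mod_cast ncard_edgeBoundary_le S)
    rw [hS1, hS2, mul_add]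
    have := mul_le_mul_of_nonneg_left hbd hm.le
    linarith

/-! ### The truncated density and two bounds on its gradient -/

/-- The density of `P^n(x, z)` with respect to the degree measure, truncated below at `σ`. -/
def truncatedDensity (G : SimpleGraph V) [G.LocallyFinite] (n : ℕ) (σ : ℝ) (x z : V) : ℝ :=
  max (P G n x z / G.degree z - σ) 0

/-- The outgoing gradient at `x` of the truncated density with target `z`. -/
def gradient (G : SimpleGraph V) [G.LocallyFinite] (n : ℕ) (σ : ℝ) (x z : V) : ℝ :=
  ∑ y ∈ G.neighborFinset x, max (truncatedDensity G n σ x z - truncatedDensity G n σ y z) 0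

lemma truncatedDensity_nonneg (n : ℕ) (σ : ℝ) (x z : V) : 0 ≤ truncatedDensity G n σ x z :=
  le_max_right _ _

lemma gradient_nonneg (n : ℕ) (σ : ℝ) (x z : V) : 0 ≤ gradient G n σ x z :=
  Finset.sum_nonneg fun _ _ => le_max_right _ _

lemma gradient_le (n : ℕ) (σ : ℝ) (x z : V) :
    gradient G n σ x z ≤ G.degree x * truncatedDensity G n σ x z := by
  unfold gradient
  rw [← G.card_neighborFinset_eq_degree, ← nsmul_eq_mul]
  refine Finset.sum_le_card_nsmul _ _ _ fun y _ => max_le ?_ (truncatedDensity_nonneg n σ x z)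
  linarith [truncatedDensity_nonneg (G := G) n σ y z]

/-- This crude domination by the n-step kernel is what lets the transport error be charged to the
n-step oscillation of the weight. -/
lemma degree_mul_gradient_le (hd : ∀ v, 0 < G.degree v) (n : ℕ) {σ : ℝ} (hσ : 0 ≤ σ) (x z : V) :
    (G.degree z : ℝ) * gradient G n σ x z ≤ G.degree x * P G n x z := by
  have hz : (0 : ℝ) < G.degree z := by exact_mod_cast hd z
  have hp : 0 ≤ P G n x z / G.degree z := div_nonneg (P_nonneg n x z) hz.le
  have h1 : truncatedDensity G n σ x z ≤ P G n x z / G.degree z :=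
    max_le (by linarith) hp
  calc (G.degree z : ℝ) * gradient G n σ x z
      ≤ G.degree z * (G.degree x * (P G n x z / G.degree z)) := by
        gcongr
        exact (gradient_le n σ x z).trans (by gcongr)
    _ = G.degree x * P G n x z := by field_simp

lemma P_ne_zero_of_gradient_ne_zero (hd : ∀ v, 0 < G.degree v) {n : ℕ} {σ : ℝ} (hσ : 0 ≤ σ)
    {x z : V} (h : gradient G n σ x z ≠ 0) : P G n x z ≠ 0 := by
  intro h0
  have h1 := degree_mul_gradient_le hd n hσ x z
  rw [h0, mul_zero] at h1
  have hz : (0 : ℝ) < G.degree z := by exact_mod_cast hd z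
  have h2 := (gradient_nonneg n σ x z).lt_of_ne' h
  nlinarith [mul_pos hz h2]

lemma summable_mul_gradient_right (hd : ∀ v, 0 < G.degree v) (n : ℕ) {σ : ℝ} (hσ : 0 ≤ σ)
    (x : V) (f : V → ℝ) : Summable fun z => f z * gradient G n σ x z :=
  summable_of_hasFiniteSupport ((finite_support_P n x).subset fun _ hz =>
    P_ne_zero_of_gradient_ne_zero hd hσ (right_ne_zero_of_mul hz))

/-- For a fixed starting point, the gradient is controlled by the total variation profile. -/
lemma tsum_degree_mul_gradient_le (hd : ∀ v, 0 < G.degree v) (n : ℕ) {σ : ℝ} (hσ : 0 ≤ σ)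
    (x : V) : ∑' z, (G.degree z : ℝ) * gradient G n σ x z ≤
      G.degree x * (2 * tvProfile G n) := by
  have hle : ∀ z, (G.degree z : ℝ) * gradient G n σ x z ≤
      ∑ y ∈ G.neighborFinset x, |P G n x z - P G n y z| := by
    intro z
    have hz : (0 : ℝ) < G.degree z := by exact_mod_cast hd z
    unfold gradient
    rw [Finset.mul_sum]
    refine Finset.sum_le_sum fun y _ => ?_
    -- Truncation and positive part are 1-Lipschitz.
    have h1 : max (truncatedDensity G n σ x z - truncatedDensity G n σ y z) 0 ≤
        |P G n x z / G.degree z - P G n y z / G.degree z| := by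
      refine max_le ?_ (abs_nonneg _)
      refine (le_abs_self _).trans ((abs_max_sub_max_le_abs _ _ _).trans_eq ?_)
      congr 1
      ring
    refine (mul_le_mul_of_nonneg_left h1 hz.le).trans_eq ?_
    rw [← sub_div, abs_div, abs_of_pos hz]
    field_simp
  refine ((summable_mul_gradient_right hd n hσ x _).tsum_le_tsum hle
    (summable_sum fun y _ => summable_abs_P_sub n x y)).trans ?_
  rw [Summable.tsum_finsetSum fun y _ => summable_abs_P_sub n x y,
    ← G.card_neighborFinset_eq_degree, ← nsmul_eq_mul]
  refine Finset.sum_le_card_nsmul _ _ _ fun y hy => tsum_abs_P_sub_le hd n ?_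
  rw [SimpleGraph.mem_neighborFinset] at hy
  exact mem_closedNbhd.2 (Or.inr hy)

lemma degree_mul_density (hd : ∀ v, 0 < G.degree v) (n : ℕ) (x z : V) :
    (G.degree x : ℝ) * (P G n x z / G.degree z) = P G n z x := by
  have hz : (G.degree z : ℝ) ≠ 0 := by exact_mod_cast (hd z).ne'
  rw [← mul_div_assoc, degree_mul_P hd]
  field_simp

/-- An entropy bound keeps a definite part of the mass after truncation. -/
lemma one_div_four_le_tsum_truncatedDensity (hd : ∀ v, 0 < G.degree v) {M : ℕ}
    (hdeg : ∀ v, G.degree v ≤ M) (n : ℕ) {H σ : ℝ} (hH : 0 < H)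
    (hσ : 2 * M * σ ≤ Real.exp (-(2 * H))) (hσ0 : 0 ≤ σ) (z : V) (hent : entropy G n z ≤ H)
    (hs : Summable fun x => (G.degree x : ℝ) * truncatedDensity G n σ x z) :
    1 / 4 ≤ ∑' x, (G.degree x : ℝ) * truncatedDensity G n σ x z := by
  -- A pointwise Markov inequality. Where -log P ≥ 2H the left side is nonpositive; elsewhere P ≥
  -- exp(-2H) ≥ 2Mσ, so truncation removes at most half of P. Summing gives 1/2 - 1/4.
  have hle : ∀ x, 1 / 2 * P G n z x - 1 / (4 * H) * (P G n z x * -Real.log (P G n z x)) ≤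
      (G.degree x : ℝ) * truncatedDensity G n σ x z := by
    intro x
    have hx : (0 : ℝ) < G.degree x := by exact_mod_cast hd x
    have hxM : (G.degree x : ℝ) ≤ M := by exact_mod_cast hdeg x
    have hlog : 0 ≤ -Real.log (P G n z x) :=
      neg_nonneg.2 (Real.log_nonpos (P_nonneg n z x) (P_le_one hd n z x))
    have hP := P_nonneg (G := G) n z x
    rcases le_or_gt (2 * H) (-Real.log (P G n z x)) with h | h
    · refine le_trans ?_ (mul_nonneg hx.le (truncatedDensity_nonneg n σ x z))
      have h1 : 1 / (4 * H) * (P G n z x * (2 * H)) ≤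
          1 / (4 * H) * (P G n z x * -Real.log (P G n z x)) := by gcongr
      have h2 : 1 / (4 * H) * (P G n z x * (2 * H)) = 1 / 2 * P G n z x := by
        field_simp
        ring
      linarith
    · rcases hP.eq_or_lt with h0 | h0
      · rw [← h0]
        simpa using mul_nonneg hx.le (truncatedDensity_nonneg n σ x z)
      have h1 : Real.exp (-(2 * H)) ≤ P G n z x := by
        rw [← Real.le_log_iff_exp_le h0]
        linarith
      have h2 : (G.degree x : ℝ) * (P G n x z / G.degree z - σ) ≤
          G.degree x * truncatedDensity G n σ x z :=
        mul_le_mul_of_nonneg_left (le_max_left _ _) hx.le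
      rw [mul_sub, degree_mul_density hd] at h2
      have h3 : (G.degree x : ℝ) * σ ≤ M * σ := by gcongr
      have h4 : 0 ≤ 1 / (4 * H) * (P G n z x * -Real.log (P G n z x)) := by positivity
      linarith
  have h := (((summable_P n z).mul_left _).sub
    ((summable_P_mul n z _).mul_left _)).tsum_le_tsum hle hs
  rw [((summable_P n z).mul_left _).tsum_sub ((summable_P_mul n z _).mul_left _), tsum_mul_left,
    tsum_mul_left, tsum_P hd] at h
  have h5 : 1 / (4 * H) * entropy G n z ≤ 1 / 4 := by
    calc 1 / (4 * H) * entropy G n z ≤ 1 / (4 * H) * H := by gcongr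
      _ = 1 / 4 := by field_simp
  rw [entropy] at h5
  linarith

/-- For a fixed target, the gradient is bounded below by the isoperimetric profile. -/
lemma isoProfile_div_four_le_tsum_gradient (hd : ∀ v, 0 < G.degree v) {M : ℕ}
    (hdeg : ∀ v, G.degree v ≤ M) (n N : ℕ) {H σ : ℝ} (hH : 0 < H) (hσ0 : 0 < σ)
    (hσ : 2 * M * σ ≤ Real.exp (-(2 * H))) (hN : 1 ≤ N * σ) (z : V)
    (hent : entropy G n z ≤ H) :
    isoProfile G N / 4 ≤ ∑' x, gradient G n σ x z := by
  classical
  have hz : (0 : ℝ) < G.degree z := by exact_mod_cast hd z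
  have hfin : (Function.support fun x => truncatedDensity G n σ x z).Finite := by
    refine (finite_support_P_left hd n z).subset fun x hx h0 => hx ?_
    have h0' : P G n x z = 0 := h0
    simp [truncatedDensity, h0', hσ0.le]
  set S := hfin.toFinset with hS
  have hnot : ∀ x ∉ S, truncatedDensity G n σ x z = 0 := by
    intro x hx
    simpa [hS] using hx
  have hpos : ∀ x ∈ S, 0 < truncatedDensity G n σ x z := by
    intro x hx
    refine (truncatedDensity_nonneg n σ x z).lt_of_ne' ?_
    simpa [hS] using hx
  -- On the support the density exceeds σ, while its total mass is 1: the volume is at most 1/σ ≤ N.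
  have hvol : ∀ W ⊆ S, vol G W ≤ N := by
    intro W hW
    have h1 : (vol G W : ℝ) * σ ≤ ∑ x ∈ W, P G n z x := by
      rw [vol_eq_sum, Finset.sum_mul]
      refine Finset.sum_le_sum fun x hx => ?_
      have h2 := hpos x (hW hx)
      rw [truncatedDensity, lt_max_iff, or_iff_left (lt_irrefl _)] at h2
      rw [← degree_mul_density hd n x z]
      exact mul_le_mul_of_nonneg_left (by linarith) (Nat.cast_nonneg _)
    have h3 : ∑ x ∈ W, P G n z x ≤ 1 := by
      rw [← tsum_P hd n z]
      exact (summable_P n z).sum_le_tsum W fun x _ => P_nonneg n z x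
    have h4 : (vol G W : ℝ) * σ ≤ N * σ := by linarith
    exact_mod_cast le_of_mul_le_mul_right h4 hσ0
  have hco := mul_sum_le_sum_gradient (φ := isoProfile G N) S
    (fun x => truncatedDensity G n σ x z) hpos hnot
    fun W hW hne => isoProfile_mul_vol_le hd hne (hvol W hW)
  have hmass := one_div_four_le_tsum_truncatedDensity hd hdeg n hH hσ hσ0.le z hent
    (summable_degree_mul hfin)
  rw [tsum_eq_sum fun x hx => by rw [hnot x hx, mul_zero]] at hmass
  have hgrad : ∑' x, gradient G n σ x z = ∑ x ∈ S, gradient G n σ x z :=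
    tsum_eq_sum fun x hx => le_antisymm
      ((gradient_le n σ x z).trans_eq (by rw [hnot x hx, mul_zero])) (gradient_nonneg n σ x z)
  rw [hgrad]
  calc isoProfile G N / 4 = isoProfile G N * (1 / 4) := by ring
    _ ≤ _ := mul_le_mul_of_nonneg_left hmass (isoProfile_nonneg N)
    _ ≤ _ := hco

/-! ### Mass transport -/

/-- Mass transport between the two estimates on the gradient, along an almost invariant
function. -/
lemma isoProfile_mul_tsum_le (hd : ∀ v, 0 < G.degree v) {M : ℕ}
    (hdeg : ∀ v, G.degree v ≤ M) (n N : ℕ) {H σ : ℝ} (hH : 0 < H) (hσ0 : 0 < σ)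
    (hσ : 2 * M * σ ≤ Real.exp (-(2 * H))) (hN : 1 ≤ N * σ) (hent : ∀ z, entropy G n z ≤ H)
    {u : V → ℝ} (hu0 : ∀ x, 0 ≤ u x) (hu : (Function.support u).Finite) :
    isoProfile G N / 4 * ∑' x, (G.degree x : ℝ) * u x ≤
      2 * tvProfile G n * ∑' x, (G.degree x : ℝ) * u x + n * oscillation G u := by
  have hT := fun x z (h : gradient G n σ x z ≠ 0) =>
    P_ne_zero_of_gradient_ne_zero hd hσ0.le h
  have hT' := fun x z (h : gradient G n σ x z ≠ 0) => P_ne_zero_symm hd (hT x z h)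
  have hs1 : ∀ z x, (G.degree z : ℝ) * u z * gradient G n σ x z ≠ 0 →
      (z ∈ Function.support u ∨ x ∈ Function.support u) ∧ P G n z x ≠ 0 := fun z x h =>
    ⟨Or.inl (right_ne_zero_of_mul (left_ne_zero_of_mul h)), hT' x z (right_ne_zero_of_mul h)⟩
  have hs2 : ∀ z x, u x * ((G.degree z : ℝ) * gradient G n σ x z) ≠ 0 →
      (z ∈ Function.support u ∨ x ∈ Function.support u) ∧ P G n z x ≠ 0 := fun z x h =>
    ⟨Or.inr (left_ne_zero_of_mul h),
      hT' x z (right_ne_zero_of_mul (right_ne_zero_of_mul h))⟩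
  have hs3 : ∀ z x, (G.degree z : ℝ) * (P G n z x * |u z - u x|) ≠ 0 →
      (z ∈ Function.support u ∨ x ∈ Function.support u) ∧ P G n z x ≠ 0 := fun z x h => by
    refine ⟨?_, left_ne_zero_of_mul (right_ne_zero_of_mul h)⟩
    by_contra! h'
    simp only [Function.mem_support, not_not] at h'
    exact h (by simp [h'.1, h'.2])
  have hk1 := summable_kernel hd hu hs1
  have hk2 := summable_kernel hd hu hs2
  have hk3 := summable_kernel hd hu hs3
  calc isoProfile G N / 4 * ∑' z, (G.degree z : ℝ) * u z
      = ∑' z, (G.degree z : ℝ) * u z * (isoProfile G N / 4) := by rw [mul_comm, tsum_mul_right]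
    _ ≤ ∑' z, ∑' x, (G.degree z : ℝ) * u z * gradient G n σ x z := by
        refine ((summable_degree_mul hu).mul_right _).tsum_le_tsum (fun z => ?_) hk1.prod
        rw [tsum_mul_left]
        exact mul_le_mul_of_nonneg_left (isoProfile_div_four_le_tsum_gradient hd hdeg n N hH hσ0
          hσ hN z (hent z)) (mul_nonneg (Nat.cast_nonneg _) (hu0 z))
    -- The weight moves from the target z to the starting point x; the error is |u z - u x| times a
    -- kernel dominated by deg z · P^n(z,x).
    _ ≤ ∑' z, ∑' x, (u x * ((G.degree z : ℝ) * gradient G n σ x z)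
          + (G.degree z : ℝ) * (P G n z x * |u z - u x|)) := by
        refine hk1.prod.tsum_le_tsum (fun z => (hk1.prod_factor z).tsum_le_tsum (fun x => ?_)
          ((hk2.prod_factor z).add (hk3.prod_factor z))) (hk2.add hk3).prod
        have h1 := degree_mul_gradient_le hd n hσ0.le x z
        rw [degree_mul_P hd n x z] at h1
        have h2 : (u z - u x) * (G.degree z * gradient G n σ x z) ≤
            |u z - u x| * (G.degree z * P G n z x) :=
          mul_le_mul (le_abs_self _) h1
            (mul_nonneg (Nat.cast_nonneg _) (gradient_nonneg n σ x z)) (abs_nonneg _)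
        linarith
    _ = ∑' x, u x * ∑' z, (G.degree z : ℝ) * gradient G n σ x z
          + ∑' z, (G.degree z : ℝ) * ∑' x, P G n z x * |u z - u x| := by
        simp_rw [← tsum_mul_left]
        rw [hk2.tsum_comm]
        exact (tsum_congr fun z => (hk2.prod_factor z).tsum_add (hk3.prod_factor z)).trans
          (hk2.prod.tsum_add hk3.prod)
    _ ≤ ∑' x, 2 * tvProfile G n * ((G.degree x : ℝ) * u x) + n * oscillation G u := by
        refine add_le_add ?_ (tsum_P_abs_sub_le hd hu n)
        refine Summable.tsum_le_tsum (fun x => ?_)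
          (summable_of_hasFiniteSupport (hu.subset fun x hx => left_ne_zero_of_mul hx))
          ((summable_degree_mul hu).mul_left _)
        have := mul_le_mul_of_nonneg_left (tsum_degree_mul_gradient_le hd n hσ0.le x) (hu0 x)
        linarith
    _ = _ := by rw [tsum_mul_left]

/-- The isoperimetric profile at scale `exp (O(H))` is at most a constant times the total
variation profile, where `H` bounds the entropy. -/
theorem isoProfile_le_tvProfile [Nonempty V] (hd : ∀ v, 0 < G.degree v) {M : ℕ}
    (hdeg : ∀ v, G.degree v ≤ M) (hTV : Tendsto (tvProfile G) atTop (nhds 0)) {n N : ℕ} {H : ℝ}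
    (hH : 0 < H) (hent : ∀ z, entropy G n z ≤ H) (hN : 2 * M * Real.exp (2 * H) ≤ N) :
    isoProfile G N ≤ 8 * tvProfile G n := by
  obtain ⟨o⟩ := ‹Nonempty V›
  have : Nonempty V := ⟨o⟩
  have hM : (0 : ℝ) < M := by exact_mod_cast (hd o).trans_le (hdeg o)
  set σ : ℝ := Real.exp (-(2 * H)) / (2 * M) with hσ
  have hσ0 : 0 < σ := by positivity
  have hσ1 : 2 * M * σ ≤ Real.exp (-(2 * H)) := by
    rw [hσ]
    field_simp
    exact le_rfl
  have hN' : 1 ≤ N * σ := by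
    calc (1 : ℝ) = 2 * M * Real.exp (2 * H) * σ := by
          rw [hσ, Real.exp_neg]
          field_simp
      _ ≤ N * σ := by gcongr
  have key : ∀ ε : ℝ, 0 < ε → isoProfile G N / 4 ≤ 2 * tvProfile G n + n * ε := by
    intro ε hε
    obtain ⟨u, hu0, hu, hu1, hosc⟩ := exists_oscillation_le hd hdeg hTV hε
    have h := isoProfile_mul_tsum_le hd hdeg n N hH hσ0 hσ1 hN' hent hu0 hu
    set m := ∑' x, (G.degree x : ℝ) * u x
    have h1 : (n : ℝ) * oscillation G u ≤ n * ε * m := by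
      calc (n : ℝ) * oscillation G u ≤ n * ε := by gcongr
        _ ≤ n * ε * m := le_mul_of_one_le_right (by positivity) hu1
    refine le_of_mul_le_mul_right ?_ (zero_lt_one.trans_le hu1)
    linarith
  have h0 : isoProfile G N / 4 ≤ 2 * tvProfile G n := by
    refine le_of_forall_pos_le_add fun ε hε => ?_
    -- The denominator n + 1 also covers n = 0.
    have h := key (ε / (n + 1)) (by positivity)
    have h2 : (n : ℝ) * (ε / (n + 1)) ≤ ε := by
      rw [mul_div_assoc', div_le_iff₀ (by positivity)]
      nlinarith
    linarith
  linarith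

end LazyWalk

end

/-! ### Choice of the time scale -/

theorem corollary2 {V : Type*} [Infinite V] (G : SimpleGraph V) [G.LocallyFinite]
    (hconn : G.Connected) (M : ℕ) (hdeg : ∀ v, G.degree v ≤ M)
    (α β : ℝ) (hα : α ∈ Set.Ioc (0 : ℝ) 1) (hβ : β ∈ Set.Ioc (0 : ℝ) 1)
    (hH : (fun n : ℕ => LazyWalk.entropyProfile G n) =O[atTop] fun n : ℕ => (n : ℝ) ^ α)
    (hTV : (fun n : ℕ => LazyWalk.tvProfile G n) =O[atTop] fun n : ℕ => (n : ℝ) ^ (-β)) :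
    (fun n : ℕ => LazyWalk.isoProfile G n) =O[atTop]
      fun n : ℕ => (Real.log (Real.log (n : ℝ)) / Real.log (n : ℝ)) ^ (β / α) := by
  have hα0 : 0 < α := hα.1
  have hβ0 : 0 < β := hβ.1
  have hd : ∀ v, 0 < G.degree v := fun v => hconn.preconnected.degree_pos_of_nontrivial v
  have hTV0 : Tendsto (LazyWalk.tvProfile G) atTop (nhds 0) :=
    hTV.trans_tendsto ((tendsto_rpow_neg_atTop hβ0).comp tendsto_natCast_atTop_atTop)
  obtain ⟨C, hC, hHC⟩ := hH.exists_pos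
  obtain ⟨D, hD, hTVD⟩ := hTV.exists_pos
  have hlog : Tendsto (fun N : ℕ => Real.log N) atTop atTop :=
    Real.tendsto_log_atTop.comp tendsto_natCast_atTop_atTop
  -- With this c the entropy bound H = C n^α is at most (log N)/4, so exp(2H) ≤ √N, and the other
  -- factor √N absorbs 2M.
  set c : ℝ := 1 / (4 * C) with hc
  have hc0 : 0 < c := by positivity
  have hX : Tendsto (fun N : ℕ => (c * Real.log N) ^ (1 / α)) atTop atTop :=
    (tendsto_rpow_atTop (by positivity)).comp (hlog.const_mul_atTop hc0)
  have hn : Tendsto (fun N : ℕ => ⌊(c * Real.log N) ^ (1 / α)⌋₊) atTop atTop :=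
    tendsto_nat_floor_atTop.comp hX
  have hsqrt : Tendsto (fun N : ℕ => Real.exp (Real.log N / 2)) atTop atTop :=
    Real.tendsto_exp_atTop.comp (hlog.atTop_div_const two_pos)
  refine IsBigO.of_bound (8 * (D * (2 ^ β * c ^ (-(β / α))))) ?_
  filter_upwards [hn.eventually hHC.bound, hn.eventually hTVD.bound,
    hX.eventually_ge_atTop 1, hsqrt.eventually_ge_atTop (2 * (M : ℝ)),
    (Real.tendsto_log_atTop.comp hlog).eventually_ge_atTop 1, hlog.eventually_gt_atTop 0,
    eventually_gt_atTop 0] with N hHN hTVN hXN hMN hll hL hN0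
  set L := Real.log N with hLdef
  set X := (c * L) ^ (1 / α) with hXdef
  set n := ⌊X⌋₊
  have hcL : 0 < c * L := by positivity
  have hX0 : 0 < X := by positivity
  have hn1 : 1 ≤ n := Nat.one_le_floor_iff _ |>.2 hXN
  have hn0 : (0 : ℝ) < n := by exact_mod_cast hn1
  have hnX : (n : ℝ) ≤ X := Nat.floor_le hX0.le
  have hXn : X / 2 ≤ n := by
    have h1 : X < n + 1 := Nat.lt_floor_add_one X
    have h2 : (1 : ℝ) ≤ n := by exact_mod_cast hn1
    linarith
  have hHn : C * (n : ℝ) ^ α ≤ L / 4 := by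
    calc C * (n : ℝ) ^ α ≤ C * X ^ α := by gcongr
      _ = L / 4 := by
        rw [hXdef, ← Real.rpow_mul hcL.le, one_div_mul_cancel hα0.ne', Real.rpow_one, hc]
        field_simp
  have hiso : LazyWalk.isoProfile G N ≤ 8 * LazyWalk.tvProfile G n := by
    have := hconn.nonempty
    refine LazyWalk.isoProfile_le_tvProfile hd hdeg hTV0 (H := C * (n : ℝ) ^ α)
      (by positivity) (fun z => ?_) ?_
    · refine (LazyWalk.entropy_le_entropyProfile hd hdeg n z).trans ((le_abs_self _).trans ?_)
      rwa [Real.norm_eq_abs, Real.norm_of_nonneg (by positivity)] at hHN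
    · calc 2 * (M : ℝ) * Real.exp (2 * (C * (n : ℝ) ^ α))
          ≤ Real.exp (L / 2) * Real.exp (L / 2) := by
            gcongr
            linarith
        _ = N := by
            rw [← Real.exp_add, add_halves, hLdef, Real.exp_log (by exact_mod_cast hN0)]
  have htv : LazyWalk.tvProfile G n ≤ D * (n : ℝ) ^ (-β) := by
    rw [Real.norm_eq_abs, Real.norm_of_nonneg (by positivity)] at hTVN
    exact (le_abs_self _).trans hTVN
  have hpow : (n : ℝ) ^ (-β) ≤ 2 ^ β * c ^ (-(β / α)) * (Real.log L / L) ^ (β / α) := by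
    calc (n : ℝ) ^ (-β) ≤ (X / 2) ^ (-β) :=
          Real.rpow_le_rpow_of_nonpos (by positivity) hXn (by linarith)
      _ = 2 ^ β * c ^ (-(β / α)) * (1 / L) ^ (β / α) := by
          rw [Real.div_rpow hX0.le two_pos.le, hXdef, ← Real.rpow_mul hcL.le,
            Real.rpow_neg two_pos.le, div_inv_eq_mul, show 1 / α * -β = -(β / α) by ring,
            Real.mul_rpow hc0.le hL.le, one_div, Real.inv_rpow hL.le, Real.rpow_neg hL.le]
          ring
      -- The iterated logarithm enters only here, by enlarging the numerator from 1 to log L ≥ 1.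
      _ ≤ _ := by
          have : (1 : ℝ) ≤ Real.log L := hll
          gcongr
  have hll0 : (0 : ℝ) ≤ Real.log L := zero_le_one.trans hll
  rw [Real.norm_of_nonneg (LazyWalk.isoProfile_nonneg N), Real.norm_of_nonneg (by positivity)]
  calc LazyWalk.isoProfile G N ≤ 8 * (D * (n : ℝ) ^ (-β)) := by linarith
    _ ≤ 8 * (D * (2 ^ β * c ^ (-(β / α)) * (Real.log L / L) ^ (β / α))) := by gcongr
    _ = _ := by ring
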